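/- Let $K$ be a field of arbitrary characteristic and let $V$ be an algebraic variety over $K$ (more generally, any scheme of finite type over $K$; $V$ need not be irreducible, reduced, separated or affine). Let $V(K)$ be its set of $K$-rational points; if $K$ is algebraically closed, these are all the points of $V$ in the classical sense. Suppose that $V(K)$ carries the structure of an associative ring, not necessarily with $1$, whose addition and multiplication are algebraic, i.e. each of them is induced by a morphism $V\times_K V\to V$ over $K$ (a polynomial map if $V$ is affine). Let $\mathbb{Z}\langle x,y\rangle$ be the free associative unitary ring on two generators. Then every ring homomorphism $\phi:\mathbb{Z}\langle x,y\rangle\to V(K)$ (an additive and multiplicative map, not required to preserve any unit) has a nontrivial kernel: there is $r\in\mathbb{Z}\langle x,y\rangle$ with $r\neq 0$ and $\phi(r)=0$. -/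

import Mathlib

open CategoryTheory CategoryTheory.Limits AlgebraicGeometry

universe u

/-- The set `V(K)` of `K`-rational points of a `K`-scheme `f : V ⟶ Spec K`: the morphisms
`Spec K ⟶ V` over `K`. If `K` is algebraically closed and `V` is of finite type, these are the
points of `V` in the classical sense. -/
def RationalPoint {K : Type u} [Field K] {V : Scheme.{u}} (f : V ⟶ Spec (.of K)) : Type u :=
  {a : Spec (.of K) ⟶ V // a ≫ f = 𝟙 _}

/-- The rational point `(a, b)` of `V ×_K V` given by two rational points of `V`. -/
noncomputable def RationalPoint.pair {K : Type u} [Field K] {V : Scheme.{u}}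
    {f : V ⟶ Spec (.of K)} (a b : RationalPoint f) : Spec (.of K) ⟶ pullback f f :=
  pullback.lift a.1 b.1 (a.2.trans b.2.symm)

/-- A binary operation on the rational points of `V` is algebraic if it is induced by a morphism
`V ×_K V ⟶ V` of `K`-schemes (for affine `V`: by polynomials). -/
def IsAlgebraicOperation {K : Type u} [Field K] {V : Scheme.{u}} (f : V ⟶ Spec (.of K))
    (op : RationalPoint f → RationalPoint f → RationalPoint f) : Prop :=
  ∃ m : pullback f f ⟶ V, m ≫ f = pullback.fst f f ≫ f ∧
    ∀ a b : RationalPoint f, (op a b).1 = RationalPoint.pair a b ≫ m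

/-!
The argument linearises the ring `X = V(K)` at its zero element. Let `A` be the local ring at `0` of
functions on `X` that are regular for the Zariski topology, and `m` its maximal ideal; `A` is
Noetherian, being a quotient of a localization of the coordinate ring of an affine chart. Working
with functions on `X` instead of sections of the structure sheaf means that identities between
rational points, which is all that the ring axioms give, become identities in `A`; it has the
effect of replacing `V` by the reduced closure of `V(K)`.

Every `a : X` acts on `A` by pullback along `b ↦ b * a`. On the cotangent space `m / m²`, which has
finite dimension over `K`, this is a homomorphism of rings `X → End_K (m / m²)`
(`RegularFunctions.cotangentAction`): the differential of a sum is the sum of the differentials.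
Endomorphisms of a finite-dimensional space satisfy a standard polynomial identity
(`standardPolynomial_eq_zero`), whereas the standard polynomial in `x, x y, x y², …` is a nonzero
element `p` of the free ring (`standardPolynomial_freeAlgebra_ne_zero`). Hence right multiplication
by `φ p` maps `m` into `m²`, and right multiplication by `φ (p ^ n)` maps `m` into `m ^ (n + 1)`.

For fixed `k`, the `a : X` whose right multiplication maps `m` into `m ^ k` form a closed set
(`RegularFunctions.IsRegularOp.isClosed_isTrivial`). As `X` is a Noetherian space, the closures of
the sets `{φ (p ^ j) | j ≥ n}` stabilise, so that for some `n` right multiplication by `φ (p ^ n)`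
maps `m` into `m ^ k` for all `k`. By Krull's intersection theorem it kills `m`, so `b * φ (p ^ n)`
vanishes for all `b` near `0`. The `b` with `b * φ (p ^ n) = 0` form an open subgroup, which has
finite index `N` by compactness. Thus `φ (N • p ^ (n + 1)) = 0`, while `N • p ^ (n + 1) ≠ 0` since
the free ring is a domain of characteristic zero. Nothing depends on the characteristic of `K`, or on
whether `V` is affine.

The geometric input about the operations is `RationalPoint.isRegularOp`: the pullback of a regular
function along a morphism `V ×_K V ⟶ V` is locally a quotient of sums `∑ᵢ uᵢ(s) vᵢ(t)`, because the
coordinate ring of a product of affine charts is the tensor product of the coordinate rings.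
-/

open Filter Topology IsLocalRing

/-! ### Germs of regular functions -/

/-- Rings of `K`-valued functions on a topological space `X`, one for each point `x`: `reg x` is to
be thought of as the ring of functions that are regular near `x`. The members of `reg x` are total
functions, whose values away from `x` are irrelevant by `congr`. -/
structure RegularFunctions (K X : Type*) [Field K] [TopologicalSpace X] where
  /-- The functions that are regular near a point. -/
  reg : X → Subalgebra K (X → K)
  congr : ∀ {x : X} {F G : X → K}, F ∈ reg x → F =ᶠ[𝓝 x] G → G ∈ reg x
  eventually_ne : ∀ {x : X} {F : X → K}, F ∈ reg x → F x ≠ 0 → ∀ᶠ y in 𝓝 x, F y ≠ 0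
  inv_mem : ∀ {x : X} {F : X → K}, F ∈ reg x → F x ≠ 0 → F⁻¹ ∈ reg x

namespace RegularFunctions

variable {K X : Type*} [Field K] [TopologicalSpace X] (R : RegularFunctions K X)

/-- The regular functions near `x` that vanish on a neighbourhood of `x`. -/
def vanishing (x : X) : Ideal (R.reg x) where
  carrier := {F | (F : X → K) =ᶠ[𝓝 x] 0}
  zero_mem' := EventuallyEq.rfl
  add_mem' {F G} hF hG := by
    filter_upwards [hF, hG] with y h1 h2
    simp_all
  smul_mem' c F hF := by
    filter_upwards [hF] with y h1
    simp_all

/-- The local ring at `x`, consisting of germs of regular functions. -/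
def Stalk (x : X) : Type _ := R.reg x ⧸ R.vanishing x

instance (x : X) : CommRing (R.Stalk x) := inferInstanceAs (CommRing (R.reg x ⧸ R.vanishing x))

instance (x : X) : Algebra K (R.Stalk x) := inferInstanceAs (Algebra K (R.reg x ⧸ R.vanishing x))

variable {x : X}

/-- The germ of a regular function. -/
def germ (F : X → K) (hF : F ∈ R.reg x) : R.Stalk x := Ideal.Quotient.mk _ ⟨F, hF⟩

theorem germ_surjective (g : R.Stalk x) : ∃ F, ∃ hF : F ∈ R.reg x, R.germ F hF = g := by
  obtain ⟨⟨F, hF⟩, rfl⟩ := Ideal.Quotient.mk_surjective g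
  exact ⟨F, hF, rfl⟩

theorem germ_eq_germ {F G : X → K} (hF : F ∈ R.reg x) (hG : G ∈ R.reg x) :
    R.germ F hF = R.germ G hG ↔ F =ᶠ[𝓝 x] G := by
  refine Ideal.Quotient.eq.trans ⟨?_, ?_⟩
  · intro h
    filter_upwards [show F - G =ᶠ[𝓝 x] 0 from h] with y hy
    exact sub_eq_zero.1 hy
  · intro h
    change F - G =ᶠ[𝓝 x] 0
    filter_upwards [h] with y hy
    simp [hy]

theorem germ_add {F G : X → K} (hF : F ∈ R.reg x) (hG : G ∈ R.reg x) :
    R.germ (F + G) (add_mem hF hG) = R.germ F hF + R.germ G hG := rfl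

theorem germ_mul {F G : X → K} (hF : F ∈ R.reg x) (hG : G ∈ R.reg x) :
    R.germ (F * G) (mul_mem hF hG) = R.germ F hF * R.germ G hG := rfl

theorem germ_smul (c : K) {F : X → K} (hF : F ∈ R.reg x) :
    R.germ (c • F) ((R.reg x).smul_mem hF c) = c • R.germ F hF := rfl

theorem const_mem (c : K) : (fun _ => c) ∈ R.reg x := (R.reg x).algebraMap_mem c

theorem germ_const (c : K) : R.germ (x := x) (fun _ => c) (R.const_mem c) = algebraMap K _ c := rfl

variable (x) in
/-- The value of a germ at its base point. -/
def value : R.Stalk x →ₐ[K] K :=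
  Ideal.Quotient.liftₐ (R.vanishing x) ((Pi.evalAlgHom K (fun _ : X => K) x).comp (R.reg x).val)
    fun F hF => EventuallyEq.eq_of_nhds (f := (F : X → K)) (g := 0) hF

@[simp]
theorem value_germ {F : X → K} (hF : F ∈ R.reg x) : R.value x (R.germ F hF) = F x := rfl

theorem isUnit_iff (g : R.Stalk x) : IsUnit g ↔ R.value x g ≠ 0 := by
  refine ⟨fun h => (h.map (R.value x)).ne_zero, fun h => ?_⟩
  obtain ⟨F, hF, rfl⟩ := R.germ_surjective g
  refine .of_mul_eq_one (R.germ F⁻¹ (R.inv_mem hF h)) ?_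
  rw [← germ_mul]
  refine (R.germ_eq_germ _ (R.const_mem 1)).2 ?_
  filter_upwards [R.eventually_ne hF h] with y hy
  simp [hy]

instance : Nontrivial (R.Stalk x) := (R.value x).toRingHom.domain_nontrivial

instance : IsLocalRing (R.Stalk x) :=
  .of_isUnit_or_isUnit_one_sub_self fun g => by
    simp only [isUnit_iff, map_sub, map_one]
    by_contra! h
    simp [h.1] at h

theorem mem_maximalIdeal_iff (g : R.Stalk x) :
    g ∈ maximalIdeal (R.Stalk x) ↔ R.value x g = 0 := by
  simp [isUnit_iff]

theorem sub_value_mem (g : R.Stalk x) :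
    g - algebraMap K _ (R.value x g) ∈ maximalIdeal (R.Stalk x) := by
  rw [mem_maximalIdeal_iff]
  simp

/-! ### Self-maps fixing a point -/

/-- A self-map of `X` that fixes `x`, is continuous there and pulls back regular functions to
regular functions. -/
structure IsRegularAt (x : X) (g : X → X) : Prop where
  map_self : g x = x
  tendsto : Tendsto g (𝓝 x) (𝓝 x)
  comp_mem : ∀ F ∈ R.reg x, F ∘ g ∈ R.reg x

variable {R}

/-- The pullback of germs along a regular self-map. -/
def IsRegularAt.pullback {g : X → X} (hg : R.IsRegularAt x g) : R.Stalk x →ₐ[K] R.Stalk x :=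
  Ideal.quotientMapₐ (R.vanishing x)
    (((AlgHom.pi fun y => Pi.evalAlgHom K (fun _ : X => K) (g y)).comp
      (R.reg x).val).codRestrict (R.reg x) fun F => hg.comp_mem F F.2)
    fun _ hF => hg.tendsto.eventually hF

theorem IsRegularAt.pullback_germ {g : X → X} (hg : R.IsRegularAt x g) {F : X → K}
    (hF : F ∈ R.reg x) : hg.pullback (R.germ F hF) = R.germ (F ∘ g) (hg.comp_mem F hF) := rfl

theorem IsRegularAt.value_pullback {g : X → X} (hg : R.IsRegularAt x g) (a : R.Stalk x) :
    R.value x (hg.pullback a) = R.value x a := by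
  obtain ⟨F, hF, rfl⟩ := R.germ_surjective a
  rw [hg.pullback_germ]
  simp [hg.map_self]

theorem IsRegularAt.maximalIdeal_le_comap {g : X → X} (hg : R.IsRegularAt x g) :
    maximalIdeal (R.Stalk x) ≤ (maximalIdeal (R.Stalk x)).comap hg.pullback := by
  intro a ha
  rw [Ideal.mem_comap]
  rw [mem_maximalIdeal_iff] at ha ⊢
  rw [hg.value_pullback, ha]

/-- `g` is trivial to order `k`: it agrees with the constant map `x` up to terms of order `k`. -/
def IsRegularAt.IsTrivial {g : X → X} (hg : R.IsRegularAt x g) (k : ℕ) : Prop :=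
  maximalIdeal (R.Stalk x) ≤ (maximalIdeal (R.Stalk x) ^ k).comap hg.pullback

theorem IsRegularAt.IsTrivial.mono {g : X → X} {hg : R.IsRegularAt x g} {k l : ℕ} (hkl : k ≤ l)
    (h : hg.IsTrivial l) : hg.IsTrivial k :=
  h.trans (Ideal.comap_mono (Ideal.pow_le_pow_right hkl))

theorem IsRegularAt.IsTrivial.comp {g g' : X → X} {hg : R.IsRegularAt x g}
    {hg' : R.IsRegularAt x g'} (hgg' : R.IsRegularAt x (g ∘ g')) {k l : ℕ}
    (h : hg.IsTrivial k) (h' : hg'.IsTrivial l) : hgg'.IsTrivial (k * l) := by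
  intro a ha
  have e : hgg'.pullback a = hg'.pullback (hg.pullback a) := by
    obtain ⟨F, hF, rfl⟩ := R.germ_surjective a
    rfl
  rw [Ideal.mem_comap, e, mul_comm, pow_mul]
  refine Ideal.pow_right_mono (Ideal.map_le_iff_le_comap.2 h') k ?_
  rw [← Ideal.map_pow]
  exact Ideal.mem_map_of_mem _ (h ha)

/-! ### Regular binary operations -/

variable (R)

/-- The functions of two variables of the form `(s, t) ↦ ∑ᵢ uᵢ(s) vᵢ(t)` with `uᵢ` regular near `x`
and `vᵢ` regular near `y`. -/
def products (x y : X) : Submodule K (X → X → K) :=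
  Submodule.span K {G | ∃ u ∈ R.reg x, ∃ v ∈ R.reg y, G = fun s t => u s * v t}

/-- A binary operation is regular if the pullback of each regular function is locally a quotient of
sums of products of regular functions of one variable. The condition on `T` expresses that the
operation is continuous for the Zariski topology of the product, which is finer than the product
topology. -/
def IsRegularOp (op : X → X → X) : Prop :=
  ∀ x y, ∀ F ∈ R.reg (op x y), ∀ T ∈ 𝓝 (op x y), ∃ W ∈ R.products x y, ∃ G ∈ R.products x y,
    W x y ≠ 0 ∧ ∃ N ∈ 𝓝 x, ∃ N' ∈ 𝓝 y, ∀ s ∈ N, ∀ t ∈ N', W s t ≠ 0 →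
      op s t ∈ T ∧ F (op s t) * W s t = G s t

variable {R}

theorem products_left {x y : X} {G : X → X → K} (hG : G ∈ R.products x y) (t : X) :
    (fun s => G s t) ∈ R.reg x := by
  induction hG using Submodule.span_induction with
  | mem G hG =>
    obtain ⟨u, hu, v, -, rfl⟩ := hG
    exact mul_mem hu (R.const_mem (v t))
  | zero => exact zero_mem _
  | add G G' _ _ h h' => exact add_mem h h'
  | smul c G _ h => exact (R.reg x).smul_mem h c

theorem products_right {x y : X} {G : X → X → K} (hG : G ∈ R.products x y) (s : X) :
    G s ∈ R.reg y := by
  induction hG using Submodule.span_induction with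
  | mem G hG =>
    obtain ⟨u, -, v, hv, rfl⟩ := hG
    exact mul_mem (R.const_mem (u s)) hv
  | zero => exact zero_mem _
  | add G G' _ _ h h' => exact add_mem h h'
  | smul c G _ h => exact (R.reg y).smul_mem h c

theorem IsRegularOp.comp_left {op : X → X → X} (h : R.IsRegularOp op) (x y : X) {F : X → K}
    (hF : F ∈ R.reg (op x y)) : (fun s => F (op s y)) ∈ R.reg x := by
  obtain ⟨W, hW, G, hG, h0, N, hN, N', hN', H⟩ := h x y F hF Set.univ univ_mem
  have hWy := products_left hW y
  refine R.congr (mul_mem (products_left hG y) (R.inv_mem hWy h0)) ?_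
  filter_upwards [hN, R.eventually_ne hWy h0] with s hs hs'
  have := (H s hs y (mem_of_mem_nhds hN') hs').2
  simp only [Pi.mul_apply, Pi.inv_apply]
  rw [← this, mul_assoc, mul_inv_cancel₀ hs', mul_one]

theorem IsRegularOp.continuous_left {op : X → X → X} (h : R.IsRegularOp op) (y : X) :
    Continuous fun s => op s y := by
  refine continuous_iff_continuousAt.2 fun x T hT => ?_
  rw [mem_map]
  obtain ⟨W, hW, G, hG, h0, N, hN, N', hN', H⟩ := h x y 0 (zero_mem _) T hT
  have hWy := products_left hW y
  filter_upwards [hN, R.eventually_ne (x := x) hWy h0] with s hs hs'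
  exact (H s hs y (mem_of_mem_nhds hN') hs').1

end RegularFunctions

namespace RegularFunctions

variable {K X : Type*} [Field K] [TopologicalSpace X] {R : RegularFunctions K X}

/-! ### The differential of a sum -/

section Add

variable [AddZeroClass X]

/-- A sum of products in two small variables is the sum of its restrictions to the two axes, minus
its constant term, up to terms of order two. -/
theorem products_comp {g g' : X → X} (hg : R.IsRegularAt 0 g) (hg' : R.IsRegularAt 0 g')
    {G : X → X → K} (hG : G ∈ R.products 0 0) :
    ∃ (h : (fun s => G (g s) (g' s)) ∈ R.reg 0) (h₁ : (fun s => G (g s) 0) ∈ R.reg 0)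
      (h₂ : (fun s => G 0 (g' s)) ∈ R.reg 0),
      R.germ _ h - R.germ _ h₁ - R.germ _ h₂ + algebraMap K _ (G 0 0) ∈
        maximalIdeal (R.Stalk 0) ^ 2 := by
  induction hG using Submodule.span_induction with
  | mem G hG =>
    obtain ⟨u, hu, v, hv, rfl⟩ := hG
    have hu' := hg.comp_mem u hu
    have hv' := hg'.comp_mem v hv
    refine ⟨mul_mem hu' hv', mul_mem hu' (R.const_mem (v 0)), mul_mem (R.const_mem (u 0)) hv', ?_⟩
    -- the expression is `(u ∘ g - u 0) * (v ∘ g' - v 0)`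
    have hmem := Ideal.mul_mem_mul (R.sub_value_mem (R.germ _ hu')) (R.sub_value_mem (R.germ _ hv'))
    rw [← pow_two] at hmem
    convert hmem using 1
    have e := R.germ_mul hu' hv'
    have e₁ := R.germ_mul hu' (R.const_mem (v 0))
    have e₂ := R.germ_mul (R.const_mem (u 0)) hv'
    rw [germ_const] at e₁ e₂
    simp only [value_germ, Function.comp_apply, hg.map_self, hg'.map_self, map_mul]
    refine (congrArg₂ (· + ·) (congrArg₂ (· - ·) (congrArg₂ (· - ·) e e₁) e₂) rfl).trans ?_
    ring
  | zero =>
    refine ⟨zero_mem _, zero_mem _, zero_mem _, ?_⟩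
    convert Ideal.zero_mem _ using 1
    have e : R.germ (0 : X → K) (zero_mem (R.reg 0)) = 0 := rfl
    refine (congrArg₂ (· + ·) (congrArg₂ (· - ·) (congrArg₂ (· - ·) e e) e) (map_zero _)).trans ?_
    simp
  | add G G' _ _ h h' =>
    obtain ⟨h, h₁, h₂, H⟩ := h
    obtain ⟨h', h₁', h₂', H'⟩ := h'
    refine ⟨add_mem h h', add_mem h₁ h₁', add_mem h₂ h₂', ?_⟩
    convert add_mem H H' using 1
    simp only [Pi.add_apply, map_add]
    refine (congrArg₂ (· + ·) (congrArg₂ (· - ·) (congrArg₂ (· - ·) (R.germ_add h h')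
      (R.germ_add h₁ h₁')) (R.germ_add h₂ h₂')) rfl).trans ?_
    ring
  | smul c G _ h =>
    obtain ⟨h, h₁, h₂, H⟩ := h
    refine ⟨(R.reg 0).smul_mem h c, (R.reg 0).smul_mem h₁ c, (R.reg 0).smul_mem h₂ c, ?_⟩
    convert Ideal.mul_mem_left _ (algebraMap K _ c) H using 1
    simp only [Pi.smul_apply, smul_eq_mul, map_mul]
    refine (congrArg₂ (· + ·) (congrArg₂ (· - ·) (congrArg₂ (· - ·) (R.germ_smul c h)
      (R.germ_smul c h₁)) (R.germ_smul c h₂)) rfl).trans ?_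
    simp only [Algebra.smul_def]
    ring

/-- The differential at `0` of a sum of maps is the sum of the differentials. -/
theorem IsRegularOp.pullback_add_sub_mem (hadd : R.IsRegularOp (fun a b : X => a + b))
    {g g' h : X → X} (hg : R.IsRegularAt 0 g) (hg' : R.IsRegularAt 0 g') (hh : R.IsRegularAt 0 h)
    (hgh : ∀ s, h s = g s + g' s) {a : R.Stalk 0} (ha : a ∈ maximalIdeal (R.Stalk 0)) :
    hh.pullback a - hg.pullback a - hg'.pullback a ∈ maximalIdeal (R.Stalk 0) ^ 2 := by
  obtain ⟨F, hF, rfl⟩ := R.germ_surjective a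
  rw [mem_maximalIdeal_iff, value_germ] at ha
  have hF' : F ∈ R.reg (0 + 0) := by rwa [add_zero]
  obtain ⟨W, hW, G, hG, h0, N, hN, N', hN', H⟩ := hadd 0 0 F hF' Set.univ univ_mem
  obtain ⟨w, w₁, w₂, -⟩ := products_comp hg hg' hW
  obtain ⟨v, v₁, v₂, hv⟩ := products_comp hg hg' hG
  have hG0 : G 0 0 = 0 := by
    have := (H 0 (mem_of_mem_nhds hN) 0 (mem_of_mem_nhds hN') h0).2
    simpa [ha] using this.symm
  rw [hG0, map_zero, add_zero] at hv
  have e : hh.pullback (R.germ F hF) * R.germ _ w = R.germ _ v := by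
    rw [hh.pullback_germ, ← germ_mul, germ_eq_germ]
    filter_upwards [hg.tendsto hN, hg'.tendsto hN',
      R.eventually_ne w (by simpa [hg.map_self, hg'.map_self])] with s hs hs' hs''
    simpa [hgh] using (H _ hs _ hs' hs'').2
  have e₁ : hg.pullback (R.germ F hF) * R.germ _ w₁ = R.germ _ v₁ := by
    rw [hg.pullback_germ, ← germ_mul, germ_eq_germ]
    filter_upwards [hg.tendsto hN, R.eventually_ne w₁ (by simpa [hg.map_self])] with s hs hs''
    simpa using (H _ hs _ (mem_of_mem_nhds hN') hs'').2
  have e₂ : hg'.pullback (R.germ F hF) * R.germ _ w₂ = R.germ _ v₂ := by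
    rw [hg'.pullback_germ, ← germ_mul, germ_eq_germ]
    filter_upwards [hg'.tendsto hN', R.eventually_ne w₂ (by simpa [hg'.map_self])] with s hs hs''
    simpa using (H _ (mem_of_mem_nhds hN) _ hs hs'').2
  have hm : R.germ F hF ∈ maximalIdeal (R.Stalk 0) := by
    rwa [mem_maximalIdeal_iff, value_germ]
  have k := Ideal.mul_mem_mul (Ideal.mem_comap.1 (hh.maximalIdeal_le_comap hm))
    (R.sub_value_mem (R.germ _ w))
  have k₁ := Ideal.mul_mem_mul (Ideal.mem_comap.1 (hg.maximalIdeal_le_comap hm))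
    (R.sub_value_mem (R.germ _ w₁))
  have k₂ := Ideal.mul_mem_mul (Ideal.mem_comap.1 (hg'.maximalIdeal_le_comap hm))
    (R.sub_value_mem (R.germ _ w₂))
  simp only [value_germ, hg.map_self, hg'.map_self, mul_sub, e, e₁, e₂, ← pow_two] at k k₁ k₂
  have hu : IsUnit (algebraMap K (R.Stalk 0) (W 0 0)) := h0.isUnit.map _
  rw [← Ideal.unit_mul_mem_iff_mem _ hu]
  convert sub_mem hv (sub_mem (sub_mem k k₁) k₂) using 1
  ring

end Add

/-! ### Right multiplications -/

section Ring

variable [NonUnitalRing X]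

theorem IsRegularOp.isRegularAt_mul (hmul : R.IsRegularOp (fun a b : X => a * b)) (a : X) :
    R.IsRegularAt 0 (· * a) where
  map_self := zero_mul a
  tendsto := by simpa using (hmul.continuous_left a).tendsto 0
  comp_mem F hF := hmul.comp_left 0 a (by rwa [zero_mul])

/-- The maps `b ↦ b * a` that are trivial to order `k` at `0` form a Zariski-closed family: modulo
the `k`-th power of the maximal ideal, the coefficients of the pullback of a function depend
regularly on `a`, up to a common denominator. -/
theorem IsRegularOp.isClosed_isTrivial (hmul : R.IsRegularOp (fun a b : X => a * b)) (k : ℕ) :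
    IsClosed {a | (hmul.isRegularAt_mul a).IsTrivial k} := by
  refine isClosed_of_closure_subset fun a₀ ha₀ => ?_
  intro g hg
  obtain ⟨F, hF, rfl⟩ := R.germ_surjective g
  have hF' : F ∈ R.reg (0 * a₀) := by rwa [zero_mul]
  obtain ⟨W, hW, G, hG, h0, N, hN, N', hN', H⟩ := hmul 0 a₀ F hF' Set.univ univ_mem
  have key : ∀ a ∈ N', W 0 a ≠ 0 →
      ((hmul.isRegularAt_mul a).pullback (R.germ F hF) ∈ maximalIdeal (R.Stalk 0) ^ k ↔
        R.germ _ (products_left hG a) ∈ maximalIdeal (R.Stalk 0) ^ k) := by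
    intro a ha hWa
    have hw := products_left hW a
    have e : (hmul.isRegularAt_mul a).pullback (R.germ F hF) * R.germ _ hw
        = R.germ _ (products_left hG a) := by
      rw [IsRegularAt.pullback_germ, ← germ_mul, germ_eq_germ]
      filter_upwards [hN, R.eventually_ne hw hWa] with s hs hs'
      exact (H s hs a ha hs').2
    rw [← e, Ideal.mul_unit_mem_iff_mem _ ((R.isUnit_iff _).2 hWa)]
  rw [Ideal.mem_comap, key a₀ (mem_of_mem_nhds hN') h0]
  rw [← Ideal.Quotient.eq_zero_iff_mem, ← Module.forall_dual_apply_eq_zero_iff K]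
  intro l
  have hl : (fun a => l (Ideal.Quotient.mk _ (R.germ _ (products_left hG a)))) ∈ R.reg a₀ := by
    clear key H
    have h : ∀ a, (fun s => G s a) ∈ R.reg 0 := products_left hG
    change (fun a => l (Ideal.Quotient.mk _ (R.germ _ (h a)))) ∈ R.reg a₀
    induction hG using Submodule.span_induction with
    | mem G hG =>
      obtain ⟨u, hu, v, hv, rfl⟩ := hG
      convert (R.reg a₀).smul_mem hv (l (Ideal.Quotient.mk _ (R.germ _ hu))) using 1
      ext a
      have e : R.germ _ (h a) = v a • R.germ _ hu := by
        rw [← germ_smul, germ_eq_germ]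
        exact .of_eq (funext fun s => mul_comm _ _)
      rw [e, ← Ideal.Quotient.mkₐ_eq_mk K, map_smul, map_smul]
      simp [mul_comm]
    | zero =>
      convert (R.reg a₀).zero_mem using 1
      ext a
      have e : R.germ _ (h a) = 0 := rfl
      rw [e, map_zero, map_zero]
      rfl
    | add G G' hG hG' ih ih' =>
      convert add_mem (ih (products_left hG)) (ih' (products_left hG')) using 1
      ext a
      have e : R.germ _ (h a) = R.germ _ (products_left hG a) + R.germ _ (products_left hG' a) := rfl
      rw [e, map_add, map_add]
      rfl
    | smul c G hG ih =>
      convert (R.reg a₀).smul_mem (ih (products_left hG)) c using 1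
      ext a
      have e : R.germ _ (h a) = c • R.germ _ (products_left hG a) := rfl
      rw [e, ← Ideal.Quotient.mkₐ_eq_mk K, map_smul, map_smul]
      rfl
  by_contra hne
  have hev := (R.eventually_ne hl hne).and
    ((eventually_mem_set.2 hN').and (R.eventually_ne (products_right hW 0) h0))
  obtain ⟨a, ⟨ha, haN, haW⟩, ha'⟩ := mem_closure_iff_nhds.1 ha₀ _ hev
  apply ha
  rw [Ideal.Quotient.eq_zero_iff_mem.2 ((key a haN haW).1 (ha' hg)), map_zero]

/-- If `s n` is trivial to order `n` for every `n`, then right multiplication by some `s n` vanishes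
near `0`: the closures of the tails of `s` stabilise, so that some `s n` is trivial to every order,
and Krull's intersection theorem applies. -/
theorem IsRegularOp.exists_eventually_mul_eq_zero [TopologicalSpace.NoetherianSpace X]
    (hmul : R.IsRegularOp (fun a b : X => a * b)) [IsNoetherianRing (R.Stalk 0)]
    (hsep : ∃ S : Set (X → K), S ⊆ R.reg 0 ∧ S.Finite ∧
      ∀ᶠ y in 𝓝 (0 : X), (∀ F ∈ S, F y = F 0) → y = 0)
    (s : ℕ → X) (hs : ∀ n, (hmul.isRegularAt_mul (s n)).IsTrivial n) :
    ∃ n, ∀ᶠ b in 𝓝 (0 : X), b * s n = 0 := by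
  let T : ℕ →o (TopologicalSpace.Closeds X)ᵒᵈ :=
    ⟨fun n => OrderDual.toDual ⟨closure (s '' Set.Ici n), isClosed_closure⟩, fun m n hmn =>
      OrderDual.toDual_le_toDual.2 (closure_mono (Set.image_mono (Set.Ici_subset_Ici.2 hmn)))⟩
  obtain ⟨n, hn⟩ := WellFoundedGT.monotone_chain_condition T
  refine ⟨n, ?_⟩
  have hall : ∀ k, (hmul.isRegularAt_mul (s n)).IsTrivial k := by
    intro k
    have h1 : s n ∈ closure (s '' Set.Ici n) := subset_closure ⟨n, le_refl n, rfl⟩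
    have h2 : closure (s '' Set.Ici n) = closure (s '' Set.Ici (max n k)) :=
      congrArg (fun C => ((OrderDual.ofDual C : TopologicalSpace.Closeds X) : Set X))
        (hn (max n k) (le_max_left _ _))
    rw [h2] at h1
    refine closure_minimal ?_ (hmul.isClosed_isTrivial k) h1
    rintro _ ⟨j, hj, rfl⟩
    exact (hs j).mono ((le_max_right _ _).trans hj)
  have hzero : ∀ g ∈ maximalIdeal (R.Stalk 0), (hmul.isRegularAt_mul (s n)).pullback g = 0 := by
    intro g hg
    rw [← Ideal.mem_bot, ← Ideal.iInf_pow_eq_bot_of_isLocalRing (maximalIdeal (R.Stalk 0))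
      (Ideal.IsPrime.ne_top inferInstance), Ideal.mem_iInf]
    exact fun k => hall k hg
  obtain ⟨S, hS, hfin, hsep⟩ := hsep
  have hF : ∀ F ∈ S, ∀ᶠ b in 𝓝 (0 : X), F (b * s n) = F 0 := by
    intro F hF
    have hm : R.germ F (hS hF) - algebraMap K _ (F 0) ∈ maximalIdeal (R.Stalk 0) := by
      simpa using R.sub_value_mem (R.germ F (hS hF))
    have := hzero _ hm
    rw [map_sub, AlgHom.commutes, sub_eq_zero, IsRegularAt.pullback_germ, ← germ_const,
      germ_eq_germ] at this
    exact this
  filter_upwards [(hfin.eventually_all).2 hF, (hmul.isRegularAt_mul (s n)).tendsto hsep] with b h h'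
  exact h' h

/-- A subgroup containing a neighbourhood of `0` has finite index, by compactness. -/
theorem IsRegularOp.exists_nsmul_mem [CompactSpace X]
    (hadd : R.IsRegularOp (fun a b : X => a + b)) (H : AddSubgroup X) (hH : (H : Set X) ∈ 𝓝 0) :
    ∃ N : ℕ, 0 < N ∧ ∀ b, N • b ∈ H := by
  have hopen : ∀ x : X, IsOpen {y | y - x ∈ H} := by
    intro x
    rw [isOpen_iff_mem_nhds]
    intro y hy
    have ht : Tendsto (fun z => z + -y) (𝓝 y) (𝓝 0) := by
      simpa using (hadd.continuous_left (-y)).tendsto y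
    filter_upwards [ht hH] with z hz
    have : z - x = (z + -y) + (y - x) := by abel
    change z - x ∈ H
    rw [this]
    exact H.add_mem hz hy
  obtain ⟨t, ht⟩ := isCompact_univ.elim_finite_subcover (fun x => {y | y - x ∈ H}) hopen
    fun x _ => Set.mem_iUnion.2 ⟨x, by simp⟩
  have : Finite (X ⧸ H) := by
    refine Finite.of_surjective (fun x : t => (QuotientAddGroup.mk (x : X) : X ⧸ H)) ?_
    intro q
    obtain ⟨y, rfl⟩ := QuotientAddGroup.mk_surjective q
    obtain ⟨x, hx, hy⟩ := Set.mem_iUnion₂.1 (ht (Set.mem_univ y))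
    refine ⟨⟨x, hx⟩, QuotientAddGroup.eq.2 ?_⟩
    rwa [neg_add_eq_sub]
  refine ⟨Nat.card (X ⧸ H), Nat.card_pos, fun b => ?_⟩
  rw [← QuotientAddGroup.eq_zero_iff, QuotientAddGroup.mk_nsmul]
  exact card_nsmul_eq_zero'

/-- The residue field of the stalk is `K`, so generators of the cotangent space over the stalk
generate it over `K`. -/
instance [IsNoetherianRing (R.Stalk 0)] :
    Module.Finite K (maximalIdeal (R.Stalk (0 : X))).Cotangent := by
  obtain ⟨S, hS⟩ := (Module.Finite.of_surjective _ (maximalIdeal (R.Stalk (0 :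
    X))).toCotangent_surjective).fg_top
  refine ⟨S, top_unique fun t _ => ?_⟩
  have ht : t ∈ Submodule.span (R.Stalk 0) (S : Set (maximalIdeal (R.Stalk (0 : X))).Cotangent) :=
    hS ▸ Submodule.mem_top
  induction ht using Submodule.span_induction with
  | mem t ht => exact Submodule.subset_span ht
  | zero => exact zero_mem _
  | add t t' _ _ h h' => exact add_mem (h trivial) (h' trivial)
  | smul a t _ h =>
    have e : a • t = R.value 0 a • t := by
      have := Ideal.Cotangent.smul_eq_zero_of_mem (R.sub_value_mem a) t
      rwa [sub_smul, algebraMap_smul, sub_eq_zero] at this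
    rw [e]
    exact Submodule.smul_mem _ _ (h trivial)

/-- The action of the ring `X` on the cotangent space at `0` by right multiplications, which is
contravariantly functorial. -/
noncomputable def cotangentAction (hadd : R.IsRegularOp (fun a b : X => a + b))
    (hmul : R.IsRegularOp (fun a b : X => a * b)) :
    X →ₙ+* Module.End K (maximalIdeal (R.Stalk (0 : X))).Cotangent :=
  { AddMonoidHom.mk' (fun a => Ideal.mapCotangent _ _ (hmul.isRegularAt_mul a).pullback
      (hmul.isRegularAt_mul a).maximalIdeal_le_comap) fun a b => by
      ext t
      obtain ⟨t, rfl⟩ := Ideal.toCotangent_surjective _ t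
      simp only [LinearMap.add_apply, Ideal.mapCotangent_toCotangent]
      rw [← map_add, Ideal.toCotangent_eq]
      have := hadd.pullback_add_sub_mem (hmul.isRegularAt_mul a) (hmul.isRegularAt_mul b)
        (hmul.isRegularAt_mul (a + b)) (fun s => mul_add s a b) t.2
      rwa [sub_sub] at this with
    map_mul' a b := by
      ext t
      obtain ⟨⟨t, ht⟩, rfl⟩ := Ideal.toCotangent_surjective _ t
      obtain ⟨F, hF, rfl⟩ := R.germ_surjective t
      refine congrArg (Ideal.toCotangent _) (Subtype.ext ?_)
      refine (R.germ_eq_germ _ _).2 (.of_eq (funext fun s => ?_))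
      exact congrArg F (mul_assoc s a b).symm }

theorem isTrivial_two_of_cotangentAction_eq_zero (hadd : R.IsRegularOp (fun a b : X => a + b))
    (hmul : R.IsRegularOp (fun a b : X => a * b)) {a : X} (ha : cotangentAction hadd hmul a = 0) :
    (hmul.isRegularAt_mul a).IsTrivial 2 := by
  intro g hg
  have := LinearMap.congr_fun ha (Ideal.toCotangent _ ⟨g, hg⟩)
  exact (Ideal.toCotangent_eq_zero _ _).1 this

/-- If `s 0` acts trivially on the cotangent space at `0`, then right multiplication by some power
`s n = (s 0) ^ (n + 1)` is annihilated by a positive integer. -/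
theorem IsRegularOp.exists_mul_nsmul_eq_zero [TopologicalSpace.NoetherianSpace X]
    (hadd : R.IsRegularOp (fun a b : X => a + b))
    (hmul : R.IsRegularOp (fun a b : X => a * b)) [IsNoetherianRing (R.Stalk 0)]
    (hsep : ∃ S : Set (X → K), S ⊆ R.reg 0 ∧ S.Finite ∧
      ∀ᶠ y in 𝓝 (0 : X), (∀ F ∈ S, F y = F 0) → y = 0)
    (s : ℕ → X) (h0 : cotangentAction hadd hmul (s 0) = 0) (hs : ∀ n, s (n + 1) = s n * s 0) :
    ∃ n N : ℕ, 0 < N ∧ ∀ b, N • b * s n = 0 := by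
  have h2 := isTrivial_two_of_cotangentAction_eq_zero hadd hmul h0
  have htriv : ∀ n, (hmul.isRegularAt_mul (s n)).IsTrivial (n + 2) := by
    intro n
    induction n with
    | zero => exact h2
    | succ n ih =>
      have h : R.IsRegularAt 0 ((· * s 0) ∘ (· * s n)) := by
        convert hmul.isRegularAt_mul (s (n + 1)) using 1
        ext b
        simp [hs, mul_assoc]
      have := IsRegularAt.IsTrivial.comp h h2 ih
      convert this.mono (k := n + 1 + 2) (by omega) using 1
      ext b
      simp [hs, mul_assoc]
  obtain ⟨n, hn⟩ := hmul.exists_eventually_mul_eq_zero hsep s fun n => (htriv n).mono (by omega)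
  obtain ⟨N, hN, H⟩ := hadd.exists_nsmul_mem (AddMonoidHom.mulRight (s n)).ker hn
  exact ⟨n, N, hN, H⟩

end Ring

end RegularFunctions

/-! ### The standard polynomial -/

/-- The standard polynomial `∑ σ, sign σ • (v (σ 0) * v (σ 1) * ⋯)`. -/
noncomputable def standardPolynomial {A : Type*} [Ring A] {n : ℕ} (v : Fin n → A) : A :=
  ∑ σ : Equiv.Perm (Fin n), (Equiv.Perm.sign σ : ℤ) • (List.ofFn fun i => v (σ i)).prod

/-- The standard polynomial is alternating, so it vanishes on linearly dependent families. -/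
theorem standardPolynomial_eq_zero {K E : Type*} [Field K] [AddCommGroup E] [Module K E]
    [Module.Finite K E] {n : ℕ} (hn : Module.finrank K (Module.End K E) < n)
    (v : Fin n → Module.End K E) : standardPolynomial v = 0 := by
  have h : ¬ LinearIndependent K v := fun h => by
    have := h.fintype_card_le_finrank
    rw [Fintype.card_fin] at this
    exact hn.not_ge this
  have := AlternatingMap.map_linearDependent
    (MultilinearMap.alternatization (MultilinearMap.mkPiAlgebraFin K n (Module.End K E))) v h
  rw [← this, MultilinearMap.alternatization_apply, standardPolynomial]
  simp [Units.smul_def]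

/-- A homomorphism that need not preserve `1` respects nonempty products; the factor `c` makes the
product nonempty. -/
theorem map_mul_list_prod {A B : Type*} [Ring A] [Ring B] (ψ : A →ₙ+* B) (c : A) (l : List A) :
    ψ (c * l.prod) = ψ c * (l.map ψ).prod := by
  induction l generalizing c with
  | nil => simp
  | cons a l ih => rw [List.prod_cons, ← mul_assoc, ih, map_mul, List.map_cons, List.prod_cons,
      mul_assoc]

theorem map_standardPolynomial {A B : Type*} [Ring A] [Ring B] (ψ : A →ₙ+* B) {n : ℕ}
    (v : Fin n → A) :
    ψ (standardPolynomial v) = ψ 1 * standardPolynomial (fun i => ψ (v i)) := by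
  rw [← one_mul (standardPolynomial v), standardPolynomial, standardPolynomial, Finset.mul_sum,
    Finset.mul_sum, map_sum]
  refine Finset.sum_congr rfl fun σ _ => ?_
  rw [mul_smul_comm, map_zsmul, map_mul_list_prod, mul_smul_comm, List.map_ofFn]
  rfl

/-- The word `x y ^ k₁ x y ^ k₂ ⋯` in the letters `x = 0` and `y = 1`. -/
def blockWord (l : List ℕ) : FreeMonoid (Fin 2) :=
  (l.map fun k => FreeMonoid.of 0 * FreeMonoid.of 1 ^ k).prod

theorem blockWord_injective : Function.Injective blockWord := by
  -- reading a word from the right, count the letters `y` and store the count at each letter `x`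
  let step : Fin 2 → Function.End (ℕ × List ℕ) := fun i s =>
    if i = 0 then (0, s.1 :: s.2) else (s.1 + 1, s.2)
  have hy : ∀ k s, FreeMonoid.lift (M := Function.End (ℕ × List ℕ)) step (FreeMonoid.of 1 ^ k) s
      = (s.1 + k, s.2) := by
    intro k
    induction k with
    | zero => intro s; simp [Function.End.one_def]
    | succ k ih =>
      intro s
      rw [pow_succ, map_mul, FreeMonoid.lift_eval_of]
      refine (ih _).trans ?_
      simp [step]
      omega
  have h : ∀ l, FreeMonoid.lift (M := Function.End (ℕ × List ℕ)) step (blockWord l) (0, [])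
      = (0, l) := by
    intro l
    induction l with
    | nil => simp [blockWord, Function.End.one_def]
    | cons k l ih =>
      have e : blockWord (k :: l) = FreeMonoid.of 0 * FreeMonoid.of 1 ^ k * blockWord l := by
        simp [blockWord]
      rw [e, map_mul, map_mul, FreeMonoid.lift_eval_of]
      change step 0 (FreeMonoid.lift (M := Function.End (ℕ × List ℕ)) step (FreeMonoid.of 1 ^ k)
        (FreeMonoid.lift (M := Function.End (ℕ × List ℕ)) step (blockWord l) (0, []))) = _
      rw [ih, hy]
      simp [step]
  intro l l' hl
  have := h l
  rw [hl, h l'] at this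
  exact (Prod.ext_iff.1 this).2.symm

/-- The monomials of the standard polynomial in `x, x y, x y², …` are distinct words. -/
theorem standardPolynomial_freeAlgebra_ne_zero (n : ℕ) :
    standardPolynomial (fun i : Fin n => FreeAlgebra.ι ℤ (0 : Fin 2) * FreeAlgebra.ι ℤ 1 ^ (i : ℕ))
      ≠ 0 := by
  intro h
  have h' := congrArg (FreeAlgebra.equivMonoidAlgebraFreeMonoid (R := ℤ) (X := Fin 2)) h
  have hword : ∀ σ : Equiv.Perm (Fin n),
      FreeAlgebra.equivMonoidAlgebraFreeMonoid (R := ℤ) (X := Fin 2)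
        (List.ofFn fun i => FreeAlgebra.ι ℤ (0 : Fin 2) * FreeAlgebra.ι ℤ 1 ^ (σ i : ℕ)).prod
      = MonoidAlgebra.of ℤ _ (blockWord (List.ofFn fun i => (σ i : ℕ))) := by
    intro σ
    rw [blockWord, map_list_prod, map_list_prod, List.map_ofFn, List.map_map, List.map_ofFn]
    congr 2
    ext1 i
    simp only [Function.comp_apply, map_mul, map_pow]
    congr 1 <;> simp [FreeAlgebra.equivMonoidAlgebraFreeMonoid]
  have hinj : Function.Injective fun σ : Equiv.Perm (Fin n) =>
      blockWord (List.ofFn fun i => (σ i : ℕ)) := by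
    intro σ τ h
    ext i
    exact congrFun (List.ofFn_injective (blockWord_injective h)) i
  rw [standardPolynomial, map_sum, map_zero] at h'
  simp only [map_zsmul, hword] at h'
  have h1 := congrArg (fun a : MonoidAlgebra ℤ (FreeMonoid (Fin 2)) =>
    a.coeff (blockWord (List.ofFn fun i => ((1 : Equiv.Perm (Fin n)) i : ℕ)))) h'
  simp only [MonoidAlgebra.of_apply, MonoidAlgebra.coeff_sum, MonoidAlgebra.coeff_smul,
    MonoidAlgebra.coeff_single, Finsupp.finsetSum_apply, Finsupp.smul_apply] at h1
  rw [Finset.sum_eq_single (1 : Equiv.Perm (Fin n))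
    (fun σ _ hσ => by rw [Finsupp.single_eq_of_ne (hinj.ne hσ.symm), smul_zero]) (by simp)] at h1
  simp at h1

/-! ### A relation in a ring with regular operations -/

namespace RegularFunctions

theorem IsRegularOp.exists_freeAlgebra_relation {K X : Type*} [Field K] [TopologicalSpace X]
    {R : RegularFunctions K X} [NonUnitalRing X]
    [TopologicalSpace.NoetherianSpace X] (hadd : R.IsRegularOp (fun a b : X => a + b))
    (hmul : R.IsRegularOp (fun a b : X => a * b)) [IsNoetherianRing (R.Stalk 0)]
    (hsep : ∃ S : Set (X → K), S ⊆ R.reg 0 ∧ S.Finite ∧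
      ∀ᶠ y in 𝓝 (0 : X), (∀ F ∈ S, F y = F 0) → y = 0)
    (φ : FreeAlgebra ℤ (Fin 2) →ₙ+* X) :
    ∃ r : FreeAlgebra ℤ (Fin 2), r ≠ 0 ∧ φ r = 0 := by
  let E := (maximalIdeal (R.Stalk (0 : X))).Cotangent
  let v : Fin (Module.finrank K (Module.End K E) + 1) → FreeAlgebra ℤ (Fin 2) :=
    fun i => FreeAlgebra.ι ℤ 0 * FreeAlgebra.ι ℤ 1 ^ (i : ℕ)
  let p : FreeAlgebra ℤ (Fin 2) := standardPolynomial v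
  have hp : p ≠ 0 := standardPolynomial_freeAlgebra_ne_zero _
  have h0 : cotangentAction hadd hmul (φ p) = 0 := by
    change ((cotangentAction hadd hmul).comp φ) p = 0
    rw [map_standardPolynomial, standardPolynomial_eq_zero (K := K) (E := E) (Nat.lt_succ_self _),
      mul_zero]
  obtain ⟨n, N, hN, H⟩ := hadd.exists_mul_nsmul_eq_zero hmul hsep (fun n => φ (p ^ (n + 1)))
    (by simpa using h0) (fun n => by simp [← map_mul, pow_succ])
  refine ⟨N • (p * p ^ (n + 1)), ?_, ?_⟩
  · rw [← Nat.cast_smul_eq_nsmul ℤ]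
    exact smul_ne_zero (by exact_mod_cast hN.ne') (mul_ne_zero hp (pow_ne_zero _ hp))
  · rw [map_nsmul, map_mul, ← smul_mul_assoc]
    exact H (φ p)

end RegularFunctions

/-! ### The Zariski topology on the rational points -/

section

variable {K : Type u} [Field K] {V : Scheme.{u}}

/-- The underlying point of the scheme of a `K`-valued point. -/
noncomputable def pointOf (a : Spec (.of K) ⟶ V) : V := a (IsLocalRing.closedPoint K)

theorem pointOf_comp {W : Scheme.{u}} (a : Spec (.of K) ⟶ V) (g : V ⟶ W) :
    pointOf (a ≫ g) = g (pointOf a) := by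
  exact Scheme.Hom.comp_apply a g _

theorem range_eq_singleton_pointOf (a : Spec (.of K) ⟶ V) : Set.range a = {pointOf a} := by
  ext v
  constructor
  · rintro ⟨p, rfl⟩
    exact congrArg a (Subsingleton.elim (α := PrimeSpectrum K) _ _)
  · rintro rfl
    exact ⟨_, rfl⟩

theorem exists_basicOpen_subset {A : Type u} [CommRing A] {O : Set (Spec (.of A))} (hO : IsOpen O)
    {p : Spec (.of A)} (hp : p ∈ O) :
    ∃ h : A, p ∈ (PrimeSpectrum.basicOpen h : Set (PrimeSpectrum A)) ∧
      (PrimeSpectrum.basicOpen h : Set (PrimeSpectrum A)) ⊆ O := by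
  obtain ⟨_, ⟨h, rfl⟩, hh⟩ :=
    (PrimeSpectrum.isTopologicalBasis_basic_opens (R := A)).exists_subset_of_mem_open hp hO
  exact ⟨h, hh⟩

theorem pointOf_map_mem_basicOpen {A : Type u} [CommRing A] (θ : A →+* K) (h : A) :
    pointOf (Spec.map (CommRingCat.ofHom θ)) ∈ (PrimeSpectrum.basicOpen h : Set (PrimeSpectrum A)) ↔
      θ h ≠ 0 := by
  have e : IsLocalRing.closedPoint K = ⊥ := Subsingleton.elim _ _
  rw [pointOf, e]
  exact Iff.rfl

namespace RationalPoint

variable {f : V ⟶ Spec (.of K)}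

/-- The Zariski topology on the set of rational points. -/
noncomputable instance : TopologicalSpace (RationalPoint f) :=
  .induced (fun a => pointOf a.1) inferInstance

instance [LocallyOfFiniteType f] [QuasiCompact f] :
    TopologicalSpace.NoetherianSpace (RationalPoint f) := by
  have : IsLocallyNoetherian V := LocallyOfFiniteType.isLocallyNoetherian f
  have : CompactSpace V := QuasiCompact.compactSpace_of_compactSpace f
  have : AlgebraicGeometry.IsNoetherian V := {}
  exact Topology.IsInducing.noetherianSpace (i := fun a : RationalPoint f => pointOf a.1) ⟨rfl⟩

end RationalPoint

/-! ### Affine charts -/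

/-- An affine open piece `Spec A` of the `K`-scheme `V`. -/
structure AffineChart (f : V ⟶ Spec (.of K)) where
  /-- The coordinate ring. -/
  A : Type u
  [commRing : CommRing A]
  [algebra : Algebra K A]
  /-- The inclusion. -/
  ι : Spec (.of A) ⟶ V
  [isOpenImmersion : IsOpenImmersion ι]
  ι_comp : ι ≫ f = Spec.map (CommRingCat.ofHom (algebraMap K A))

namespace AffineChart

attribute [instance] commRing algebra isOpenImmersion

variable {f : V ⟶ Spec (.of K)}

theorem exists_mem_range (f : V ⟶ Spec (.of K)) (v : V) :
    ∃ c : AffineChart f, v ∈ Set.range c.ι := by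
  let i := V.affineOpenCover.idx v
  let A := V.affineOpenCover.X i
  let ι : Spec A ⟶ V := V.affineOpenCover.f i
  exact ⟨{ A := A, algebra := (Spec.preimage (ι ≫ f)).hom.toAlgebra, ι := ι,
           ι_comp := (Spec.map_preimage (ι ≫ f)).symm }, V.affineOpenCover.covers v⟩

theorem isNoetherianRing [LocallyOfFiniteType f] (c : AffineChart f) : IsNoetherianRing c.A := by
  have : IsLocallyNoetherian V := LocallyOfFiniteType.isLocallyNoetherian f
  have := isLocallyNoetherian_of_isOpenImmersion c.ι
  exact isLocallyNoetherian_Spec.1 this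

variable (c : AffineChart f)

/-- `c.Evaluates a θ` means that the rational point `a` lies in the chart `c`, and that `θ` is the
evaluation at `a` of the members of the coordinate ring. -/
def Evaluates (a : RationalPoint f) (θ : c.A →+* K) : Prop :=
  Spec.map (CommRingCat.ofHom θ) ≫ c.ι = a.1

variable {c}

theorem Evaluates.unique {a : RationalPoint f} {θ θ' : c.A →+* K} (h : c.Evaluates a θ)
    (h' : c.Evaluates a θ') : θ = θ' := by
  have := Spec.map_injective ((cancel_mono c.ι).1 (Eq.trans h (Eq.symm h')))
  exact congrArg CommRingCat.Hom.hom this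

theorem Evaluates.eq {a b : RationalPoint f} {θ : c.A →+* K} (h : c.Evaluates a θ)
    (h' : c.Evaluates b θ) : a = b :=
  Subtype.ext (Eq.trans (Eq.symm h) h')

theorem Evaluates.comp_algebraMap {a : RationalPoint f} {θ : c.A →+* K} (h : c.Evaluates a θ) :
    θ.comp (algebraMap K c.A) = RingHom.id K := by
  have h1 : Spec.map (CommRingCat.ofHom θ) ≫ c.ι ≫ f = 𝟙 _ := by
    rw [← Category.assoc, show Spec.map (CommRingCat.ofHom θ) ≫ c.ι = a.1 from h, a.2]
  rw [c.ι_comp, ← Spec.map_comp, ← CommRingCat.ofHom_comp, ← Spec.map_id] at h1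
  exact congrArg CommRingCat.Hom.hom (Spec.map_injective h1)

theorem Evaluates.pointOf_eq {a : RationalPoint f} {θ : c.A →+* K} (h : c.Evaluates a θ) :
    pointOf a.1 = c.ι (pointOf (Spec.map (CommRingCat.ofHom θ))) := by
  rw [← pointOf_comp]
  exact congrArg pointOf (Eq.symm h)

/-- Evaluation as a homomorphism of `K`-algebras. -/
def Evaluates.algHom {a : RationalPoint f} {θ : c.A →+* K} (h : c.Evaluates a θ) : c.A →ₐ[K] K :=
  { θ with commutes' := fun k => RingHom.congr_fun h.comp_algebraMap k }

theorem exists_evaluates {a : RationalPoint f} (ha : pointOf a.1 ∈ Set.range c.ι) :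
    ∃ θ, c.Evaluates a θ := by
  have hr : Set.range a.1 ⊆ Set.range c.ι := by
    rw [range_eq_singleton_pointOf]
    exact Set.singleton_subset_iff.2 ha
  refine ⟨(Spec.preimage (IsOpenImmersion.lift c.ι a.1 hr)).hom, ?_⟩
  rw [Evaluates, CommRingCat.ofHom_hom, Spec.map_preimage, IsOpenImmersion.lift_fac]

theorem nonvanishing_mem_nhds {a : RationalPoint f} {θ : c.A →+* K} (ha : c.Evaluates a θ)
    {h : c.A} (hh : θ h ≠ 0) : {b | ∃ θ', c.Evaluates b θ' ∧ θ' h ≠ 0} ∈ 𝓝 a := by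
  rw [nhds_induced]
  refine ⟨c.ι '' (PrimeSpectrum.basicOpen h : Set (PrimeSpectrum c.A)),
    (c.ι.isOpenEmbedding.isOpenMap _ (PrimeSpectrum.basicOpen h).2).mem_nhds
      ⟨_, (pointOf_map_mem_basicOpen θ h).2 hh, ha.pointOf_eq.symm⟩, ?_⟩
  rintro b ⟨p, hp, hpb⟩
  obtain ⟨θ', hθ'⟩ := exists_evaluates (c := c) (a := b) ⟨p, hpb⟩
  refine ⟨θ', hθ', (pointOf_map_mem_basicOpen θ' h).1 ?_⟩
  replace hpb := hpb.trans hθ'.pointOf_eq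
  rwa [← c.ι.isOpenEmbedding.injective hpb]

theorem exists_nonvanishing_subset {a : RationalPoint f} {θ : c.A →+* K} (ha : c.Evaluates a θ)
    {T : Set (RationalPoint f)} (hT : T ∈ 𝓝 a) :
    ∃ h : c.A, θ h ≠ 0 ∧ ∀ b θ', c.Evaluates b θ' → θ' h ≠ 0 → b ∈ T := by
  rw [nhds_induced] at hT
  obtain ⟨O, hO, hOT⟩ := hT
  obtain ⟨O', hO'O, hO', haO'⟩ := mem_nhds_iff.1 hO
  obtain ⟨h, hh, hsub⟩ := exists_basicOpen_subset (hO'.preimage c.ι.continuous)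
    (p := pointOf (Spec.map (CommRingCat.ofHom θ))) (Eq.subst (motive := (· ∈ O')) ha.pointOf_eq haO')
  refine ⟨h, (pointOf_map_mem_basicOpen θ h).1 hh, fun b θ' hb hb' => hOT (hO'O ?_)⟩
  have := hsub ((pointOf_map_mem_basicOpen θ' h).2 hb')
  exact Eq.subst (motive := (· ∈ O')) hb.pointOf_eq.symm this

variable (c)

open Classical in
/-- A member of the coordinate ring as a function on the rational points, extended by `0` outside
the chart. -/
noncomputable def toFun (g : c.A) (a : RationalPoint f) : K :=
  if h : ∃ θ, c.Evaluates a θ then h.choose g else 0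

variable {c}

theorem Evaluates.toFun_eq {a : RationalPoint f} {θ : c.A →+* K} (h : c.Evaluates a θ) (g : c.A) :
    c.toFun g a = θ g := by
  have h' : ∃ θ, c.Evaluates a θ := ⟨θ, h⟩
  rw [toFun, dif_pos h', h'.choose_spec.unique h]

variable (c)

/-- The functions on the rational points that are quotients of members of the coordinate ring of `c`
near the point at which `θ` evaluates. -/
def regularAt {a : RationalPoint f} {θ : c.A →+* K} (_ha : c.Evaluates a θ) :
    Subalgebra K (RationalPoint f → K) where
  carrier := {F | ∃ g h : c.A, θ h ≠ 0 ∧ ∀ b θ', c.Evaluates b θ' → θ' h ≠ 0 → F b * θ' h = θ' g}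
  mul_mem' := by
    rintro F F' ⟨g, h, hh, H⟩ ⟨g', h', hh', H'⟩
    refine ⟨g * g', h * h', by simp [hh, hh'], fun b θ' hb hne => ?_⟩
    rw [map_mul] at hne
    rw [map_mul, map_mul, ← H b θ' hb (left_ne_zero_of_mul hne),
      ← H' b θ' hb (right_ne_zero_of_mul hne), Pi.mul_apply]
    ring
  add_mem' := by
    rintro F F' ⟨g, h, hh, H⟩ ⟨g', h', hh', H'⟩
    refine ⟨g * h' + g' * h, h * h', by simp [hh, hh'], fun b θ' hb hne => ?_⟩
    rw [map_mul] at hne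
    rw [map_mul, map_add, map_mul, map_mul, ← H b θ' hb (left_ne_zero_of_mul hne),
      ← H' b θ' hb (right_ne_zero_of_mul hne), Pi.add_apply]
    ring
  algebraMap_mem' k :=
    ⟨algebraMap K c.A k, 1, by simp, fun b θ' hb _ => by
      rw [map_one, mul_one]
      exact (RingHom.congr_fun hb.comp_algebraMap k).symm⟩

variable {c}

theorem toFun_mem_regularAt {a : RationalPoint f} {θ : c.A →+* K} (ha : c.Evaluates a θ) (g : c.A) :
    c.toFun g ∈ c.regularAt ha :=
  ⟨g, 1, by simp, fun b θ' hb _ => by rw [map_one, mul_one, hb.toFun_eq]⟩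

end AffineChart

/-! ### The local rings of functions on the rational points -/

namespace RationalPoint

variable {f : V ⟶ Spec (.of K)}

theorem exists_chart (a : RationalPoint f) : ∃ (c : AffineChart f) (θ : c.A →+* K),
    c.Evaluates a θ :=
  let ⟨c, hc⟩ := AffineChart.exists_mem_range f (pointOf a.1)
  ⟨c, AffineChart.exists_evaluates hc⟩

/-- A chosen affine chart around a rational point. -/
noncomputable def chart (a : RationalPoint f) : AffineChart f := a.exists_chart.choose

/-- The evaluation at a rational point in its chosen chart. -/
noncomputable def eval (a : RationalPoint f) : a.chart.A →+* K := a.exists_chart.choose_spec.choose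

theorem evaluates (a : RationalPoint f) : a.chart.Evaluates a a.eval :=
  a.exists_chart.choose_spec.choose_spec

variable (f) in
/-- The regular functions on the set of rational points. -/
noncomputable def regularFunctions : RegularFunctions K (RationalPoint f) where
  reg a := a.chart.regularAt a.evaluates
  congr := by
    rintro a F G ⟨g, h, hh, H⟩ hFG
    obtain ⟨k, hk, hk'⟩ := AffineChart.exists_nonvanishing_subset a.evaluates hFG
    refine ⟨g * k, h * k, by simp [hh, hk], fun b θ hb hne => ?_⟩
    rw [map_mul] at hne
    have e : F b = G b := hk' b θ hb (right_ne_zero_of_mul hne)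
    rw [map_mul, map_mul, ← H b θ hb (left_ne_zero_of_mul hne), e, mul_assoc]
  eventually_ne := by
    rintro a F ⟨g, h, hh, H⟩ hF
    have hg : a.eval (g * h) ≠ 0 := by
      rw [map_mul, ← H a _ a.evaluates hh]
      exact mul_ne_zero (mul_ne_zero hF hh) hh
    filter_upwards [AffineChart.nonvanishing_mem_nhds a.evaluates hg]
    rintro b ⟨θ, hb, hne⟩ h0
    rw [map_mul] at hne
    refine left_ne_zero_of_mul hne ?_
    rw [← H b θ hb (right_ne_zero_of_mul hne), h0, zero_mul]
  inv_mem := by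
    rintro a F ⟨g, h, hh, H⟩ hF
    have hg : a.eval g ≠ 0 := by
      rw [← H a _ a.evaluates hh]
      exact mul_ne_zero hF hh
    refine ⟨h * h, g * h, by simp [hh, hg], fun b θ hb hne => ?_⟩
    rw [map_mul] at hne
    have hgh := H b θ hb (right_ne_zero_of_mul hne)
    have hFb : F b ≠ 0 := fun h0 => left_ne_zero_of_mul hne (by rw [← hgh, h0, zero_mul])
    rw [map_mul, map_mul, ← hgh, Pi.inv_apply, ← mul_assoc, ← mul_assoc, inv_mul_cancel₀ hFb,
      one_mul]

theorem mem_reg_iff {a : RationalPoint f} {F : RationalPoint f → K} :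
    F ∈ (regularFunctions f).reg a ↔ ∃ g h : a.chart.A, a.eval h ≠ 0 ∧
      ∀ b θ, a.chart.Evaluates b θ → θ h ≠ 0 → F b * θ h = θ g :=
  Iff.rfl

theorem toFun_mem_reg (a : RationalPoint f) (g : a.chart.A) :
    a.chart.toFun g ∈ (regularFunctions f).reg a :=
  AffineChart.toFun_mem_regularAt a.evaluates g

/-- The germ at `a` of a member of the coordinate ring of the chart around `a`. -/
noncomputable def toStalk (a : RationalPoint f) : a.chart.A →+* (regularFunctions f).Stalk a :=
  have hne : ∀ᶠ b in 𝓝 a, ∃ θ, a.chart.Evaluates b θ :=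
    mem_of_superset (AffineChart.nonvanishing_mem_nhds a.evaluates (h := 1) (by simp))
      fun _ ⟨θ, hθ, _⟩ => ⟨θ, hθ⟩
  { toFun g := (regularFunctions f).germ _ (a.toFun_mem_reg g)
    map_one' := by
      refine ((regularFunctions f).germ_eq_germ _ (one_mem _)).2 ?_
      filter_upwards [hne] with b ⟨θ, hθ⟩
      rw [hθ.toFun_eq, map_one, Pi.one_apply]
    map_zero' := by
      refine ((regularFunctions f).germ_eq_germ _ (zero_mem _)).2 ?_
      filter_upwards [hne] with b ⟨θ, hθ⟩
      rw [hθ.toFun_eq, map_zero, Pi.zero_apply]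
    map_mul' g g' := by
      rw [← RegularFunctions.germ_mul, RegularFunctions.germ_eq_germ]
      filter_upwards [hne] with b ⟨θ, hθ⟩
      rw [hθ.toFun_eq, map_mul, Pi.mul_apply, hθ.toFun_eq, hθ.toFun_eq]
    map_add' g g' := by
      rw [← RegularFunctions.germ_add, RegularFunctions.germ_eq_germ]
      filter_upwards [hne] with b ⟨θ, hθ⟩
      rw [hθ.toFun_eq, map_add, Pi.add_apply, hθ.toFun_eq, hθ.toFun_eq] }

theorem value_toStalk (a : RationalPoint f) (g : a.chart.A) :
    (regularFunctions f).value a (a.toStalk g) = a.eval g :=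
  a.evaluates.toFun_eq g

/-- The stalk is a quotient of a localization of the coordinate ring. -/
instance [LocallyOfFiniteType f] (a : RationalPoint f) :
    IsNoetherianRing ((regularFunctions f).Stalk a) := by
  have := a.chart.isNoetherianRing
  have hprime : (RingHom.ker a.eval).IsPrime := RingHom.ker_isPrime _
  have hunit : ∀ y : (RingHom.ker a.eval).primeCompl, IsUnit (a.toStalk y) := fun y => by
    rw [RegularFunctions.isUnit_iff, value_toStalk]
    exact y.2
  have := IsLocalization.isNoetherianRing (RingHom.ker a.eval).primeCompl
    (Localization (RingHom.ker a.eval).primeCompl) this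
  refine isNoetherianRing_of_surjective (Localization (RingHom.ker a.eval).primeCompl) _
    (IsLocalization.lift hunit) fun s => ?_
  obtain ⟨F, hF, rfl⟩ := (regularFunctions f).germ_surjective s
  obtain ⟨g, h, hh, H⟩ := mem_reg_iff.1 hF
  refine ⟨IsLocalization.mk' _ g (⟨h, hh⟩ : (RingHom.ker a.eval).primeCompl), ?_⟩
  rw [IsLocalization.lift_mk'_spec]
  change (regularFunctions f).germ _ (a.toFun_mem_reg g) =
    (regularFunctions f).germ _ (a.toFun_mem_reg h) * _
  rw [← RegularFunctions.germ_mul, RegularFunctions.germ_eq_germ]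
  filter_upwards [AffineChart.nonvanishing_mem_nhds a.evaluates hh] with b ⟨θ, hθ, hne⟩
  rw [Pi.mul_apply, hθ.toFun_eq, hθ.toFun_eq, mul_comm, H b θ hθ hne]

/-- Generators of the maximal ideal of a rational point separate it from its neighbours. -/
theorem exists_finite_separating [LocallyOfFiniteType f] (a : RationalPoint f) :
    ∃ S : Set (RationalPoint f → K), S ⊆ (regularFunctions f).reg a ∧ S.Finite ∧
      ∀ᶠ b in 𝓝 a, (∀ F ∈ S, F b = F a) → b = a := by
  have := a.chart.isNoetherianRing
  obtain ⟨S, hS⟩ := (isNoetherianRing_iff_ideal_fg _).1 this (RingHom.ker a.eval)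
  refine ⟨a.chart.toFun '' S, ?_, S.finite_toSet.image _, ?_⟩
  · rintro _ ⟨g, -, rfl⟩
    exact a.toFun_mem_reg g
  · filter_upwards [AffineChart.nonvanishing_mem_nhds a.evaluates (h := 1) (by simp)]
    rintro b ⟨θ, hθ, -⟩ hb
    have hker : RingHom.ker a.eval ≤ RingHom.ker θ := by
      rw [← hS, Ideal.span_le]
      intro g hg
      have h1 := hb _ ⟨g, hg, rfl⟩
      rw [hθ.toFun_eq, a.evaluates.toFun_eq] at h1
      have h2 : g ∈ RingHom.ker a.eval := hS ▸ Ideal.subset_span hg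
      exact h1.trans h2
    have : θ = a.eval := by
      ext g
      have hg : g - algebraMap K _ (a.eval g) ∈ RingHom.ker a.eval := by
        rw [RingHom.mem_ker, map_sub, sub_eq_zero]
        exact (RingHom.congr_fun a.evaluates.comp_algebraMap _).symm
      have hg' := hker hg
      rw [RingHom.mem_ker, map_sub, sub_eq_zero] at hg'
      exact hg'.trans (RingHom.congr_fun hθ.comp_algebraMap _)
    subst this
    exact hθ.eq a.evaluates

end RationalPoint

end

/-! ### Algebraic operations are regular -/

open scoped TensorProduct

section

variable {K : Type u} [Field K] {V : Scheme.{u}} {f : V ⟶ Spec (.of K)}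

namespace AffineChart

variable (c d : AffineChart f)

/-- The morphism from the spectrum of the tensor product of two coordinate rings to the product. -/
noncomputable def prodMap : Spec (.of (c.A ⊗[K] d.A)) ⟶ pullback f f :=
  pullback.lift
    (Spec.map (CommRingCat.ofHom Algebra.TensorProduct.includeLeftRingHom) ≫ c.ι)
    (Spec.map (CommRingCat.ofHom
      (Algebra.TensorProduct.includeRight (R := K) (A := c.A) (B := d.A)).toRingHom) ≫ d.ι) (by
    rw [Category.assoc, Category.assoc, c.ι_comp, d.ι_comp, ← Spec.map_comp, ← Spec.map_comp,
      ← CommRingCat.ofHom_comp, ← CommRingCat.ofHom_comp]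
    congr 2
    ext k
    exact (Algebra.TensorProduct.includeLeft (R := K) (S := K) (A := c.A) (B := d.A)).commutes k
      |>.trans ((Algebra.TensorProduct.includeRight (R := K) (A := c.A) (B := d.A)).commutes k).symm)

variable {c d}

/-- Evaluation at a pair of rational points. -/
noncomputable def Evaluates.prod {a b : RationalPoint f} {θ : c.A →+* K} {η : d.A →+* K}
    (ha : c.Evaluates a θ) (hb : d.Evaluates b η) : c.A ⊗[K] d.A →+* K :=
  (Algebra.TensorProduct.productMap ha.algHom hb.algHom).toRingHom

theorem Evaluates.prod_tmul {a b : RationalPoint f} {θ : c.A →+* K} {η : d.A →+* K}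
    (ha : c.Evaluates a θ) (hb : d.Evaluates b η) (g : c.A) (h : d.A) :
    ha.prod hb (g ⊗ₜ h) = θ g * η h :=
  Algebra.TensorProduct.productMap_apply_tmul ha.algHom hb.algHom g h

theorem Evaluates.map_prod_comp {a b : RationalPoint f} {θ : c.A →+* K} {η : d.A →+* K}
    (ha : c.Evaluates a θ) (hb : d.Evaluates b η) :
    Spec.map (CommRingCat.ofHom (ha.prod hb)) ≫ prodMap c d = RationalPoint.pair a b := by
  apply pullback.hom_ext
  · rw [Category.assoc, prodMap, pullback.lift_fst, RationalPoint.pair, pullback.lift_fst,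
      ← Category.assoc, ← Spec.map_comp, ← CommRingCat.ofHom_comp, ← ha]
    congr 3
    ext g
    exact (ha.prod_tmul hb g 1).trans (by simp)
  · rw [Category.assoc, prodMap, pullback.lift_snd, RationalPoint.pair, pullback.lift_snd,
      ← Category.assoc, ← Spec.map_comp, ← CommRingCat.ofHom_comp, ← hb]
    congr 3
    ext g
    exact (ha.prod_tmul hb 1 g).trans (by simp)

end AffineChart

namespace RationalPoint

/-- A member of the tensor product of coordinate rings is a sum of products of functions. -/
theorem exists_mem_products (a b : RationalPoint f) (t : a.chart.A ⊗[K] b.chart.A) :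
    ∃ G ∈ (regularFunctions f).products a b, ∀ a' b' θ η (ha : a.chart.Evaluates a' θ)
      (hb : b.chart.Evaluates b' η), G a' b' = ha.prod hb t := by
  induction t using TensorProduct.induction_on with
  | zero => exact ⟨0, zero_mem _, fun a' b' θ η ha hb => by rw [map_zero]; rfl⟩
  | tmul g h =>
    refine ⟨fun s t => a.chart.toFun g s * b.chart.toFun h t,
      Submodule.subset_span ⟨_, a.toFun_mem_reg g, _, b.toFun_mem_reg h, rfl⟩,
      fun a' b' θ η ha hb => ?_⟩
    rw [ha.prod_tmul hb, ← ha.toFun_eq, ← hb.toFun_eq]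
  | add t t' h h' =>
    obtain ⟨G, hG, H⟩ := h
    obtain ⟨G', hG', H'⟩ := h'
    refine ⟨G + G', add_mem hG hG', fun a' b' θ η ha hb => ?_⟩
    rw [map_add, ← H a' b' θ η ha hb, ← H' a' b' θ η ha hb]
    rfl

/-- An operation that is induced by a morphism `V ×_K V ⟶ V` is regular. -/
theorem isRegularOp {op : RationalPoint f → RationalPoint f → RationalPoint f}
    (h : IsAlgebraicOperation f op) : (regularFunctions f).IsRegularOp op := by
  obtain ⟨m, -, hm⟩ := h
  intro a b F hF T hT
  set z := op a b
  obtain ⟨g, h, hh, H⟩ := mem_reg_iff.1 hF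
  obtain ⟨k, hk, hkT⟩ := AffineChart.exists_nonvanishing_subset z.evaluates hT
  let μ := AffineChart.prodMap a.chart b.chart ≫ m
  have hμ : ∀ {a' b' θ η} (ha : a.chart.Evaluates a' θ) (hb : b.chart.Evaluates b' η),
      Spec.map (CommRingCat.ofHom (ha.prod hb)) ≫ μ = (op a' b').1 := by
    intro a' b' θ η ha hb
    rw [← Category.assoc, ha.map_prod_comp hb, hm]
  -- a basic open neighbourhood of `(a, b)` on which `μ` takes values in the chart around `op a b`
  obtain ⟨w, hw, hwsub⟩ := exists_basicOpen_subset
    (O := μ ⁻¹' Set.range z.chart.ι) (z.chart.ι.isOpenEmbedding.isOpen_range.preimage μ.continuous)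
    (p := pointOf (Spec.map (CommRingCat.ofHom (a.evaluates.prod b.evaluates)))) (by
      rw [Set.mem_preimage, ← pointOf_comp, hμ a.evaluates b.evaluates, z.evaluates.pointOf_eq]
      exact Set.mem_range_self _)
  rw [pointOf_map_mem_basicOpen] at hw
  let B := Localization.Away w
  let loc : Spec (.of B) ⟶ Spec (.of (a.chart.A ⊗[K] b.chart.A)) :=
    Spec.map (CommRingCat.ofHom (algebraMap _ B))
  have hrange : Set.range (loc ≫ μ) ⊆ Set.range z.chart.ι := by
    rintro _ ⟨p, rfl⟩
    rw [Scheme.Hom.comp_apply]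
    apply hwsub
    rw [← PrimeSpectrum.localization_away_comap_range B w]
    exact ⟨p, rfl⟩
  let τ : z.chart.A →+* B := (Spec.preimage (IsOpenImmersion.lift z.chart.ι (loc ≫ μ) hrange)).hom
  have hτ : Spec.map (CommRingCat.ofHom τ) ≫ z.chart.ι = loc ≫ μ := by
    rw [CommRingCat.ofHom_hom, Spec.map_preimage, IsOpenImmersion.lift_fac]
  obtain ⟨i, g₁, hg₁⟩ := IsLocalization.Away.surj w (τ (g * k))
  obtain ⟨j, h₁, hh₁⟩ := IsLocalization.Away.surj w (τ (h * k))
  have key : ∀ {a' b' θ η} (ha : a.chart.Evaluates a' θ) (hb : b.chart.Evaluates b' η),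
      ha.prod hb w ≠ 0 → ∃ ζ, z.chart.Evaluates (op a' b') ζ ∧
        ζ (g * k) * ha.prod hb w ^ i = ha.prod hb g₁ ∧
        ζ (h * k) * ha.prod hb w ^ j = ha.prod hb h₁ := by
    intro a' b' θ η ha hb hne
    let ω : B →+* K := IsLocalization.Away.lift w hne.isUnit
    have hω : ∀ t, ω (algebraMap _ B t) = ha.prod hb t := IsLocalization.Away.lift_eq w hne.isUnit
    refine ⟨ω.comp τ, ?_, ?_, ?_⟩
    · rw [AffineChart.Evaluates, CommRingCat.ofHom_comp, Spec.map_comp, Category.assoc, hτ,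
        ← Category.assoc, ← Spec.map_comp, ← CommRingCat.ofHom_comp, ← hμ ha hb]
      congr 3
      exact RingHom.ext hω
    · rw [← hω, ← hω, ← hg₁, map_mul ω, map_pow ω]
      rfl
    · rw [← hω, ← hω, ← hh₁, map_mul ω, map_pow ω]
      rfl
  -- the factor `w` makes sure that a nonzero denominator implies that `key` applies
  obtain ⟨W, hW, hW'⟩ := exists_mem_products a b (h₁ * w ^ i * w)
  obtain ⟨G, hG, hG'⟩ := exists_mem_products a b (g₁ * w ^ j * w)
  refine ⟨W, hW, G, hG, ?_, _,
    AffineChart.nonvanishing_mem_nhds a.evaluates (h := 1) (by simp), _,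
    AffineChart.nonvanishing_mem_nhds b.evaluates (h := 1) (by simp), ?_⟩
  · obtain ⟨ζ, hζ, -, h2⟩ := key a.evaluates b.evaluates hw
    rw [hW' _ _ _ _ a.evaluates b.evaluates, map_mul, map_mul, map_pow, ← h2,
      hζ.unique z.evaluates, map_mul]
    exact mul_ne_zero (mul_ne_zero (mul_ne_zero (mul_ne_zero hh hk) (pow_ne_zero _ hw))
      (pow_ne_zero _ hw)) hw
  · rintro s ⟨θ, hs, -⟩ t ⟨η, ht, -⟩ hne
    rw [hW' _ _ _ _ hs ht, map_mul, map_mul, map_pow] at hne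
    obtain ⟨ζ, hζ, h1, h2⟩ := key hs ht (right_ne_zero_of_mul hne)
    rw [← h2, map_mul] at hne
    have hζk : ζ h * ζ k ≠ 0 := left_ne_zero_of_mul (left_ne_zero_of_mul (left_ne_zero_of_mul hne))
    refine ⟨hkT _ ζ hζ (right_ne_zero_of_mul hζk), ?_⟩
    rw [hW' _ _ _ _ hs ht, hG' _ _ _ _ hs ht, map_mul, map_mul, map_mul, map_mul, map_pow, map_pow,
      ← h1, ← h2, map_mul, map_mul, ← H _ ζ hζ (left_ne_zero_of_mul hζk)]
    ring

end RationalPoint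

end

theorem theorem9 {K : Type u} [Field K] {V : Scheme.{u}} (f : V ⟶ Spec (.of K))
    [LocallyOfFiniteType f] [QuasiCompact f] [NonUnitalRing (RationalPoint f)]
    (hadd : IsAlgebraicOperation f (fun a b => a + b))
    (hmul : IsAlgebraicOperation f (fun a b => a * b))
    (φ : FreeAlgebra ℤ (Fin 2) →ₙ+* RationalPoint f) :
    ∃ r : FreeAlgebra ℤ (Fin 2), r ≠ 0 ∧ φ r = 0 :=
  (RationalPoint.isRegularOp hadd).exists_freeAlgebra_relation (RationalPoint.isRegularOp hmul)
    (RationalPoint.exists_finite_separating 0) φ
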